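/- Let $(Z_n)_{n\ge 0}$ be a Galton–Watson process with $Z_0=1$ and offspring distribution $\{p_k\}_{k\ge 0}$, where $p_0=0$ and $0<p_1<1$. Let $m=E[Z_1]=\sum_k kp_k$ (finite by the tail assumption below, and $>1$), and let $\gamma>0$ be defined by $m^{-\gamma}=p_1$. Suppose that $$P(Z_1>x)\sim x^{-\beta}L(x)\quad (x\to\infty),\qquad 1<\beta<2,$$ with $L$ slowly varying at infinity, and that either $\gamma<\beta-1$ or $E[Z_1^{1+\gamma}]<\infty$. Then the limits $$q_k=\lim_{n\to\infty}m^{\gamma n}P(Z_n=k),\qquad k\ge 1,$$ exist and are finite, and for every $\varepsilon>0$ $$\lim_{n\to\infty}m^{\gamma n}P\left(\left|\frac{Z_{n+1}}{Z_n}-m\right|\ge\varepsilon\right)=\sum_{k\ge 1}q_k\,\phi(k,\varepsilon)<\infty,$$ where $\phi(k,\varepsilon)=P\left(\left|\frac1k\sum_{i=1}^k\xi_i-m\right|\ge\varepsilon\right)$ and $\xi_1,\xi_2,\dots$ are i.i.d. with the law of $Z_1$. -/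

import Mathlib

open MeasureTheory ProbabilityTheory Filter Topology Asymptotics

/-- A function slowly varying at infinity: positive and measurable on a neighbourhood of infinity,
with `L (c x) / L x → 1` as `x → ∞` for every `c > 0`. -/
structure IsSlowlyVarying (L : ℝ → ℝ) : Prop where
  pos_measurable : ∃ a : ℝ, (∀ x, a ≤ x → 0 < L x) ∧ Measurable ((Set.Ici a).domRestrict L)
  tendsto_ratio : ∀ c : ℝ, 0 < c → Tendsto (fun x => L (c * x) / L x) atTop (𝓝 1)

namespace GaltonWatson

/-- The process `Z 0 = 1`, `Z (n + 1) = ∑_{i < Z n} ξ n i`, where `ξ n i` is the number of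
children of the `i`-th individual of generation `n`. -/
def Z {Ω : Type*} (ξ : ℕ → ℕ → Ω → ℕ) : ℕ → Ω → ℕ
  | 0, _ => 1
  | n + 1, ω => ∑ i ∈ Finset.range (Z ξ n ω), ξ n i ω

/-- `ξ` is an array of independent random variables, all with law `p`. -/
structure IsOffspringArray {Ω : Type*} [MeasurableSpace Ω] (μ : Measure Ω) (p : PMF ℕ)
    (ξ : ℕ → ℕ → Ω → ℕ) : Prop where
  measurable : ∀ n i, Measurable (ξ n i)
  indep : iIndepFun (fun a : ℕ × ℕ => ξ a.1 a.2) μ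
  law : ∀ n i, μ.map (ξ n i) = p.toMeasure

/-- The mean `m = ∑ k p_k` of the offspring law. -/
noncomputable def mean (p : PMF ℕ) : ℝ := ∑' k : ℕ, (k : ℝ) * (p k).toReal

/-- The Schröder constant: the number `γ` with `m ^ (-γ) = p_1`. -/
noncomputable def schroder (p : PMF ℕ) : ℝ := -Real.logb (mean p) (p 1).toReal

/-- `φ(k, ε)`: the probability that the sample mean of `k` independent variables with law `p`
differs from `m` by at least `ε`. -/
noncomputable def meanDeviation (p : PMF ℕ) (k : ℕ) (ε : ℝ) : ℝ :=
  (Measure.pi (fun _ : Fin k => p.toMeasure)).real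
    {x | ε ≤ |(1 / (k : ℝ)) * (∑ i, (x i : ℝ)) - mean p|}

end GaltonWatson

/-! Write `p₁` for `p 1`. Since `m ^ (-γ) = p₁`, the scaling `m ^ (γ n)` is `p₁ ^ (-n)`. The root
may have exactly one child, so `P(Z_{n+1} = k) ≥ p₁ P(Z_n = k)` and `scaledLaw p n k` is
nondecreasing in `n`. Hence `q k` is a supremum, and conditioning on `Z_n` turns the deviation
probability into a series whose terms increase to `q k * φ(k, ε)`. Dominated convergence finishes
the proof once that limiting series is summable.

Summability combines two bounds. Generating functions give `∑_{k ≤ m^N} q k ≤ B * p₁ ^ (-N) = B * m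
^ (γ N)` (`IsRegular.exists_sum_scaledLaw_le`). Truncation at level `k` and Chebyshev give, for
large `k`, `φ(k, ε) ≤ C * E[min(k, ξ² / k)]` (`meanDeviation_le`). Grouping `k` by powers of `m`
leaves `∑_N m ^ (γ N) * E[min(m^N, ξ² / m^N)]`, which is at most a constant times `E[ξ ^ (1 + γ)]`
when `0 < γ < 1` (`sum_pow_mul_min_le`).

Regular variation of the tail only supplies the finite mean, `E[ξ ^ (1 + γ)] < ∞` and `γ < 1`
(`isRegular_schroder`). -/

namespace GaltonWatson

open scoped ENNReal

/-! ### Generation laws and their generating functions. -/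

/-- The law of the sum of `k` independent variables with law `p`. -/
noncomputable def sumLaw (p : PMF ℕ) (k : ℕ) : PMF ℕ :=
  haveI : IsProbabilityMeasure ((Measure.pi (fun _ : Fin k => p.toMeasure)).map
      (fun x => ∑ i, x i)) :=
    Measure.isProbabilityMeasure_map (Measurable.of_discrete.aemeasurable)
  ((Measure.pi (fun _ : Fin k => p.toMeasure)).map (fun x => ∑ i, x i)).toPMF

/-- The law of the `n`-th generation started from `j` individuals. -/
noncomputable def genLaw (p : PMF ℕ) : ℕ → ℕ → PMF ℕ
  | 0, j => PMF.pure j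
  | n + 1, j => (genLaw p n j).bind (sumLaw p)

/-- The probability generating function. -/
noncomputable def pgf (p : PMF ℕ) (s : ℝ≥0∞) : ℝ≥0∞ := ∑' k, p k * s ^ k

lemma sumLaw_apply (p : PMF ℕ) (k j : ℕ) :
    sumLaw p k j = Measure.pi (fun _ : Fin k => p.toMeasure) {x | ∑ i, x i = j} := by
  rw [sumLaw, Measure.toPMF_apply, Measure.map_apply Measurable.of_discrete (by simp)]
  rfl

lemma sumLaw_toMeasure (p : PMF ℕ) (k : ℕ) :
    (sumLaw p k).toMeasure =
      (Measure.pi (fun _ : Fin k => p.toMeasure)).map (fun x => ∑ i, x i) := by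
  simp [sumLaw]

lemma sumLaw_one (p : PMF ℕ) : sumLaw p 1 = p := by
  rw [← PMF.toMeasure_inj, sumLaw_toMeasure]
  have h := (measurePreserving_eval (fun _ : Fin 1 => p.toMeasure) 0).map_eq
  refine Eq.trans ?_ h
  congr 1

/-- Decomposition at the first generation, whereas `genLaw` is defined by decomposing at the last
one. -/
lemma genLaw_succ_eq_bind (p : PMF ℕ) (n j : ℕ) :
    genLaw p (n + 1) j = (sumLaw p j).bind (genLaw p n) := by
  induction n with
  | zero =>
    rw [genLaw, genLaw, PMF.pure_bind]
    exact (PMF.bind_pure _).symm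
  | succ n ih =>
    rw [genLaw, ih, PMF.bind_bind]
    rfl

/-- Keep only the event that the root has a single child. This is the source of all monotonicity in
`n`. -/
lemma mul_genLaw_le_genLaw_succ (p : PMF ℕ) (n k : ℕ) :
    p 1 * genLaw p n 1 k ≤ genLaw p (n + 1) 1 k := by
  rw [genLaw_succ_eq_bind, PMF.bind_apply, sumLaw_one]
  exact ENNReal.le_tsum (f := fun a => p a * genLaw p n a k) 1

lemma lintegral_toMeasure (p : PMF ℕ) (f : ℕ → ℝ≥0∞) :
    ∫⁻ x, f x ∂p.toMeasure = ∑' k, p k * f k := by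
  simp [lintegral_countable', PMF.toMeasure_apply_singleton, mul_comm]

lemma pgf_sumLaw (p : PMF ℕ) (k : ℕ) (s : ℝ≥0∞) : pgf (sumLaw p k) s = pgf p s ^ k := by
  rw [pgf, ← lintegral_toMeasure, sumLaw_toMeasure,
    lintegral_map Measurable.of_discrete Measurable.of_discrete]
  simp_rw [← Finset.prod_pow_eq_pow_sum]
  have hi := iIndepFun_pi (μ := fun _ : Fin k => p.toMeasure) (X := fun _ x => s ^ x)
    (fun _ => Measurable.of_discrete.aemeasurable)
  rw [lintegral_prod_eq_prod_lintegral_of_indepFun Finset.univ _ hi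
    (fun i => Measurable.of_discrete.comp (measurable_pi_apply i))]
  have (i : Fin k) : ∫⁻ x : Fin k → ℕ, s ^ x i ∂Measure.pi (fun _ : Fin k => p.toMeasure)
      = pgf p s := by
    rw [pgf, ← lintegral_toMeasure]
    exact (measurePreserving_eval (fun _ : Fin k => p.toMeasure) i).lintegral_comp
      (f := fun x => s ^ x) Measurable.of_discrete
  simp [this]

lemma pgf_bind (ν : PMF ℕ) (κ : ℕ → PMF ℕ) (s : ℝ≥0∞) :
    pgf (ν.bind κ) s = ∑' j, ν j * pgf (κ j) s := by
  simp_rw [pgf, PMF.bind_apply, ← ENNReal.tsum_mul_right, ← ENNReal.tsum_mul_left]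
  rw [ENNReal.tsum_comm]
  simp_rw [mul_assoc]

lemma pgf_genLaw (p : PMF ℕ) (n : ℕ) (s : ℝ≥0∞) : pgf (genLaw p n 1) s = (pgf p)^[n] s := by
  induction n generalizing s with
  | zero =>
    rw [genLaw, pgf, tsum_eq_single 1]
    · simp
    · intro b hb
      simp [PMF.pure_apply, hb]
  | succ n ih =>
    rw [genLaw, pgf_bind, Function.iterate_succ_apply, ← ih]
    simp_rw [pgf_sumLaw]
    rfl

/-! ### The law of the process and conditioning on a generation. -/

lemma measurable_Z_of_forall {Ω : Type*} {mΩ : MeasurableSpace Ω} {ξ : ℕ → ℕ → Ω → ℕ}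
    (n : ℕ)
    (h : ∀ j < n, ∀ i, Measurable[mΩ] (ξ j i)) : Measurable[mΩ] (Z ξ n) := by
  induction n with
  | zero => exact measurable_const
  | succ n ih =>
    have hZ := ih (fun j hj => h j (by omega))
    have hs : Measurable (fun q : ℕ × Ω => ∑ i ∈ Finset.range q.1, ξ n i q.2) :=
      measurable_from_prod_countable_right fun k =>
        Finset.measurable_sum (Finset.range k) (fun i _ => h n (by omega) i)
    exact hs.comp (hZ.prodMk measurable_id)

section OffspringArray

variable {Ω : Type*} [MeasurableSpace Ω] {μ : Measure Ω}
  {p : PMF ℕ} {ξ : ℕ → ℕ → Ω → ℕ}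

lemma IsOffspringArray.map_generation [IsProbabilityMeasure μ]
    (hξ : IsOffspringArray μ p ξ) (n k : ℕ) :
    μ.map (fun ω (i : Fin k) => ξ n i ω) = Measure.pi (fun _ : Fin k => p.toMeasure) := by
  have h : iIndepFun (fun i : Fin k => ξ n i) μ := hξ.indep.precomp
    (g := fun i : Fin k => ((n, (i : ℕ)) : ℕ × ℕ))
    (fun a b hab => Fin.ext (by simpa using hab))
  have h2 := h.map_fun_eq_pi_map (fun i : Fin k => (hξ.measurable n i).aemeasurable)
  refine h2.trans ?_
  congr 1
  ext1 i
  exact hξ.law n i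

lemma IsOffspringArray.measurable_Z (hξ : IsOffspringArray μ p ξ) (n : ℕ) :
    Measurable (Z ξ n) :=
  measurable_Z_of_forall n (fun j _ i => hξ.measurable j i)

/-- `Z ξ n` depends only on rows below `n` of the array, hence is independent of row `n`. -/
lemma IsOffspringArray.measure_inter [IsProbabilityMeasure μ]
    (hξ : IsOffspringArray μ p ξ) (n k : ℕ)
    (A : Set (Fin k → ℕ)) :
    μ ({ω | Z ξ n ω = k} ∩ {ω | (fun i : Fin k => ξ n i ω) ∈ A}) =
      μ {ω | Z ξ n ω = k} * Measure.pi (fun _ : Fin k => p.toMeasure) A := by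
  have hm : ∀ a : ℕ × ℕ, MeasurableSpace.comap (ξ a.1 a.2) inferInstance ≤ ‹MeasurableSpace Ω› :=
    fun a => (hξ.measurable a.1 a.2).comap_le
  have hdisj : Disjoint {a : ℕ × ℕ | a.1 < n} {a : ℕ × ℕ | a.1 = n} := by
    rw [Set.disjoint_left]
    rintro a h1 h2
    simp only [Set.mem_ofPred_eq] at h1 h2
    omega
  have hind := indep_iSup_of_disjoint hm hξ.indep hdisj
  have hsub (S : Set (ℕ × ℕ)) (a : ℕ × ℕ) (ha : a ∈ S) :
      Measurable[⨆ b ∈ S, MeasurableSpace.comap (ξ b.1 b.2) inferInstance] (ξ a.1 a.2) :=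
    Measurable.mono (comap_measurable _) (le_iSup₂_of_le a ha le_rfl) le_rfl
  rw [Indep_iff] at hind
  rw [hind, ← hξ.map_generation n k, Measure.map_apply _ (Set.to_countable A).measurableSet]
  · rfl
  · exact measurable_pi_lambda _ (fun i => hξ.measurable n i)
  -- Measurability is needed for the σ-algebra generated by the rows below `n`, not for the ambient
  -- one.
  · have := measurable_Z_of_forall (ξ := ξ) (mΩ := ⨆ b ∈ {a : ℕ × ℕ | a.1 < n},
      MeasurableSpace.comap (ξ b.1 b.2) inferInstance) n (fun j hj i => hsub _ (j, i) hj)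
    exact this (MeasurableSet.singleton k)
  · have := @measurable_pi_lambda Ω (Fin k) (fun _ => ℕ) (⨆ b ∈ {a : ℕ × ℕ | a.1 = n},
      MeasurableSpace.comap (ξ b.1 b.2) inferInstance) _ (fun ω i => ξ n i ω)
      (fun i => hsub {a : ℕ × ℕ | a.1 = n} (n, i) rfl)
    exact this (Set.to_countable A).measurableSet

lemma measure_eq_tsum_fiber (Y : Ω → ℕ) (hY : Measurable Y) (S : Set Ω) :
    μ S = ∑' k, μ ({ω | Y ω = k} ∩ S) := by
  have hU : S = ⋃ k, ({ω | Y ω = k} ∩ S) := by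
    ext ω; simp
  have h : ∑' k, μ ({ω | Y ω = k} ∩ S) = ∑' k, μ.restrict S {ω | Y ω = k} := by
    congr with k
    exact (Measure.restrict_apply (hY (MeasurableSet.singleton k))).symm
  rw [h, ← measure_iUnion]
  · have : (⋃ k, {ω | Y ω = k}) = Set.univ := by ext; simp
    rw [this]; simp
  · intro i j hij
    exact Set.disjoint_left.2 (fun ω h1 h2 => hij (h1.symm.trans h2))
  · exact fun k => hY (MeasurableSet.singleton k)

lemma IsOffspringArray.measure_Z_eq [IsProbabilityMeasure μ]
    (hξ : IsOffspringArray μ p ξ) (n k : ℕ) :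
    μ {ω | Z ξ n ω = k} = genLaw p n 1 k := by
  induction n generalizing k with
  | zero =>
    by_cases hk : k = 1
    · simp [Z, genLaw, hk]
    · simp [Z, genLaw, PMF.pure_apply, hk, Ne.symm hk]
  | succ n ih =>
    rw [measure_eq_tsum_fiber (Z ξ n) (hξ.measurable_Z n), genLaw, PMF.bind_apply]
    congr with j
    rw [← ih, sumLaw_apply, ← hξ.measure_inter]
    congr 1
    ext ω
    simp only [Set.mem_inter_iff, Set.mem_ofPred_eq, and_congr_right_iff]
    rintro h
    rw [Z, h, Finset.sum_range]

/-- The index `k = 0` is harmless: with division by zero equal to zero, both quotients vanish there.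
-/
lemma IsOffspringArray.measureReal_deviation [IsProbabilityMeasure μ]
    (hξ : IsOffspringArray μ p ξ) (n : ℕ) (ε : ℝ) :
    μ.real {ω | ε ≤ |(Z ξ (n + 1) ω : ℝ) / (Z ξ n ω : ℝ) - mean p|} =
      ∑' k, (genLaw p n 1 k).toReal * meanDeviation p k ε := by
  rw [measureReal_def, measure_eq_tsum_fiber (Z ξ n) (hξ.measurable_Z n), ENNReal.tsum_toReal_eq
    (fun k => measure_ne_top _ _)]
  congr with k
  rw [← hξ.measure_Z_eq, meanDeviation, measureReal_def, ← ENNReal.toReal_mul, ← hξ.measure_inter]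
  congr 2
  ext ω
  simp only [Set.mem_inter_iff, Set.mem_ofPred_eq, and_congr_right_iff]
  rintro h
  rw [Z, h, Finset.sum_range, div_eq_inv_mul, one_div]
  push_cast
  rfl

end OffspringArray

/-! ### The generating function on `[0, 1]` and the decay of its iterates. -/

/-- The probability generating function at real arguments. -/
noncomputable def realPgf (p : PMF ℕ) (s : ℝ) : ℝ := ∫ x, s ^ x ∂p.toMeasure

lemma integrable_of_abs_le (p : PMF ℕ) (f : ℕ → ℝ) (C : ℝ) (h : ∀ x, |f x| ≤ C) :
    Integrable f p.toMeasure :=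
  Integrable.of_bound Measurable.of_discrete.aestronglyMeasurable C
    (Eventually.of_forall fun x => by simpa using h x)

lemma integrable_pow (p : PMF ℕ) {s : ℝ} (h0 : 0 ≤ s) (h1 : s ≤ 1) :
    Integrable (fun x : ℕ => s ^ x) p.toMeasure :=
  integrable_of_abs_le p _ 1 fun x => by
    rw [abs_of_nonneg (by positivity)]
    exact pow_le_one₀ h0 h1

lemma realPgf_nonneg (p : PMF ℕ) {s : ℝ} (h0 : 0 ≤ s) : 0 ≤ realPgf p s :=
  integral_nonneg fun x => by positivity

lemma realPgf_mono (p : PMF ℕ) {s t : ℝ} (h0 : 0 ≤ s) (hst : s ≤ t) (h1 : t ≤ 1) :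
    realPgf p s ≤ realPgf p t :=
  integral_mono (integrable_pow p h0 (hst.trans h1)) (integrable_pow p (h0.trans hst) h1)
    fun x => pow_le_pow_left₀ h0 hst x

lemma realPgf_one (p : PMF ℕ) : realPgf p 1 = 1 := by simp [realPgf]

lemma realPgf_le_one (p : PMF ℕ) {s : ℝ} (h0 : 0 ≤ s) (h1 : s ≤ 1) : realPgf p s ≤ 1 :=
  (realPgf_mono p h0 h1 le_rfl).trans_eq (realPgf_one p)

lemma ofReal_realPgf (p : PMF ℕ) {s : ℝ} (h0 : 0 ≤ s) (h1 : s ≤ 1) :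
    ENNReal.ofReal (realPgf p s) = pgf p (ENNReal.ofReal s) := by
  rw [realPgf, ofReal_integral_eq_lintegral_ofReal (integrable_pow p h0 h1)
    (Eventually.of_forall fun x => by positivity), lintegral_toMeasure]
  simp_rw [ENNReal.ofReal_pow h0]
  rfl

lemma realPgf_iterate_mem (p : PMF ℕ) {s : ℝ} (h0 : 0 ≤ s) (h1 : s ≤ 1) (n : ℕ) :
    0 ≤ (realPgf p)^[n] s ∧ (realPgf p)^[n] s ≤ 1 := by
  induction n with
  | zero => exact ⟨h0, h1⟩
  | succ n ih =>
    rw [Function.iterate_succ_apply']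
    exact ⟨realPgf_nonneg p ih.1, realPgf_le_one p ih.1 ih.2⟩

lemma realPgf_iterate_mono (p : PMF ℕ) {s t : ℝ} (h0 : 0 ≤ s) (hst : s ≤ t) (h1 : t ≤ 1) (n : ℕ) :
    (realPgf p)^[n] s ≤ (realPgf p)^[n] t := by
  induction n with
  | zero => exact hst
  | succ n ih =>
    rw [Function.iterate_succ_apply', Function.iterate_succ_apply']
    exact realPgf_mono p (realPgf_iterate_mem p h0 (hst.trans h1) n).1 ih
      (realPgf_iterate_mem p (h0.trans hst) h1 n).2

lemma ofReal_realPgf_iterate (p : PMF ℕ) {s : ℝ} (h0 : 0 ≤ s) (h1 : s ≤ 1) (n : ℕ) :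
    ENNReal.ofReal ((realPgf p)^[n] s) = (pgf p)^[n] (ENNReal.ofReal s) := by
  induction n with
  | zero => rfl
  | succ n ih =>
    have h := realPgf_iterate_mem p h0 h1 n
    rw [Function.iterate_succ_apply', Function.iterate_succ_apply', ofReal_realPgf p h.1 h.2, ih]

lemma sum_genLaw_mul_pow_le (p : PMF ℕ) {s : ℝ} (h0 : 0 ≤ s) (h1 : s ≤ 1) (n : ℕ)
    (A : Finset ℕ) :
    ∑ k ∈ A, (genLaw p n 1 k).toReal * s ^ k ≤ (realPgf p)^[n] s := by
  have h := ENNReal.sum_le_tsum (f := fun k => genLaw p n 1 k * ENNReal.ofReal s ^ k) A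
  have h2 := pgf_genLaw p n (ENNReal.ofReal s)
  rw [← ofReal_realPgf_iterate p h0 h1, pgf] at h2
  rw [h2] at h
  rw [← ENNReal.ofReal_le_ofReal_iff (realPgf_iterate_mem p h0 h1 n).1]
  refine le_trans (le_of_eq ?_) h
  rw [ENNReal.ofReal_sum_of_nonneg fun i _ => by positivity]
  refine Finset.sum_congr rfl fun i _ => ?_
  rw [ENNReal.ofReal_mul (by positivity), ENNReal.ofReal_toReal (PMF.apply_ne_top _ _),
    ENNReal.ofReal_pow h0]

lemma ae_one_le {p : PMF ℕ} (hp0 : p 0 = 0) : ∀ᵐ x ∂p.toMeasure, 1 ≤ x := by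
  rw [ae_iff]
  have : {a : ℕ | ¬ 1 ≤ a} = {0} := by ext; simp
  rw [this, PMF.toMeasure_apply_singleton _ _ (by simp), hp0]

lemma integral_indicator_singleton (p : PMF ℕ) (k : ℕ) :
    ∫ x, ({k} : Set ℕ).indicator (fun _ => (1 : ℝ)) x ∂p.toMeasure = (p k).toReal := by
  rw [integral_indicator_const _ (by simp), measureReal_def,
    PMF.toMeasure_apply_singleton _ _ (by simp)]
  simp

/-- Since `p 0 = 0`, every value other than `1` is at least `2`, where `s ^ x ≤ s ^ 2`. -/
lemma realPgf_le (p : PMF ℕ) (hp0 : p 0 = 0) {s : ℝ} (h0 : 0 ≤ s) (h1 : s ≤ 1) :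
    realPgf p s ≤ s * ((p 1).toReal + (1 - (p 1).toReal) * s) := by
  have hi : Integrable (({1} : Set ℕ).indicator fun _ => (1 : ℝ)) p.toMeasure :=
    (integrable_const 1).indicator (by simp)
  calc realPgf p s ≤ ∫ x, ({1} : Set ℕ).indicator (fun _ => (1 : ℝ)) x * (s - s ^ 2) + s ^ 2
        ∂p.toMeasure := by
        refine integral_mono_ae (integrable_pow p h0 h1)
          ((hi.mul_const _).add (integrable_const _)) ?_
        filter_upwards [ae_one_le hp0] with x hx
        rcases hx.eq_or_lt with rfl | hx
        · simp
        · have : x ≠ 1 := by omega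
          simpa [this] using pow_le_pow_of_le_one h0 h1 hx
    _ = s * ((p 1).toReal + (1 - (p 1).toReal) * s) := by
        rw [integral_add (hi.mul_const _) (integrable_const _), integral_mul_const,
          integral_indicator_singleton]
        simp
        ring

/-- Two passes. A crude one gives geometric decay at rate `r`. Fed back, it makes the one-step
factor at most `a * (1 + r ^ n / a)`, and the product of the corrections converges, so the exact
rate `a` is recovered. -/
lemma exists_iterate_le_mul_pow {g : ℝ → ℝ} {a : ℝ} (ha0 : 0 < a) (ha1 : a < 1)
    (hg0 : ∀ s, 0 ≤ s → s ≤ 1 → 0 ≤ g s)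
    (hg : ∀ s, 0 ≤ s → s ≤ 1 → g s ≤ s * (a + (1 - a) * s)) {s : ℝ} (hs0 : 0 ≤ s) (hs1 : s < 1) :
    ∃ B, ∀ n, g^[n] s ≤ B * a ^ n := by
  set r := a + (1 - a) * s with hr
  have hr0 : 0 < r := by nlinarith
  have hr1 : r < 1 := by nlinarith
  have key (n : ℕ) : 0 ≤ g^[n] s ∧ g^[n] s ≤ s * r ^ n := by
    induction n with
    | zero => simpa using hs0
    | succ n ih =>
      rw [Function.iterate_succ_apply']
      have hn1 : g^[n] s ≤ s := ih.2.trans (mul_le_of_le_one_right hs0 (pow_le_one₀ hr0.le hr1.le))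
      refine ⟨hg0 _ ih.1 (hn1.trans hs1.le), (hg _ ih.1 (hn1.trans hs1.le)).trans ?_⟩
      have : a + (1 - a) * g^[n] s ≤ r := by nlinarith
      calc g^[n] s * (a + (1 - a) * g^[n] s) ≤ s * r ^ n * r :=
            mul_le_mul ih.2 this (by nlinarith [ih.1]) (by positivity)
        _ = s * r ^ (n + 1) := by ring
  have key2 (n : ℕ) : g^[n] s ≤ Real.exp (∑ i ∈ Finset.range n, r ^ i / a) * a ^ n := by
    induction n with
    | zero => simpa using hs1.le
    | succ n ih =>
      rw [Function.iterate_succ_apply', Finset.sum_range_succ, Real.exp_add]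
      obtain ⟨h0, h2⟩ := key n
      have hrn : s * r ^ n ≤ r ^ n := mul_le_of_le_one_left (by positivity) hs1.le
      have hn1 : g^[n] s ≤ 1 := h2.trans (hrn.trans (pow_le_one₀ hr0.le hr1.le))
      refine (hg _ h0 hn1).trans ?_
      have h3 : a + (1 - a) * g^[n] s ≤ a * Real.exp (r ^ n / a) := by
        have h4 := mul_le_mul_of_nonneg_left (Real.add_one_le_exp (r ^ n / a)) ha0.le
        have h5 : a * (r ^ n / a + 1) = r ^ n + a := by field_simp
        nlinarith
      calc g^[n] s * (a + (1 - a) * g^[n] s)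
          ≤ (Real.exp (∑ i ∈ Finset.range n, r ^ i / a) * a ^ n) * (a * Real.exp (r ^ n / a)) :=
            mul_le_mul ih h3 (by nlinarith) (by positivity)
        _ = _ := by ring
  refine ⟨Real.exp (∑' i, r ^ i / a), fun n => (key2 n).trans ?_⟩
  gcongr
  exact ((summable_geometric_of_lt_one hr0.le hr1).div_const a).sum_le_tsum _
    fun i _ => by positivity

/-! ### The generating function near `1`. -/

lemma one_sub_pow_le {t : ℝ} (h0 : 0 ≤ t) (h1 : t ≤ 1) (x : ℕ) :
    (1 - t) ^ x ≤ 1 - x * t + (x * t) ^ 2 := by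
  -- With `u = x * t`: `(1 - t) ^ x ≤ 1 / (1 + u) ≤ 1 - u + u ^ 2`, because `(1 - u + u ^ 2) * (1 +
  -- u) = 1 + u ^ 3`.
  have hb : 1 + x * t ≤ (1 + t) ^ x := one_add_mul_le_pow (by linarith) x
  have hu : 0 ≤ x * t := by positivity
  have h2 : (1 - t) ^ x * (1 + t) ^ x ≤ 1 := by
    rw [← mul_pow]
    exact pow_le_one₀ (by nlinarith) (by nlinarith)
  have h3 : 0 ≤ (1 - t) ^ x := pow_nonneg (by linarith) x
  have h4 : (1 - t) ^ x * (1 + x * t) ≤ 1 := (mul_le_mul_of_nonneg_left hb h3).trans h2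
  have h5 : 1 ≤ (1 - x * t + (x * t) ^ 2) * (1 + x * t) := by
    have : 0 ≤ (x * t) ^ 3 := by positivity
    nlinarith
  exact le_of_mul_le_mul_right (h4.trans h5) (by linarith)

lemma sub_rpow_le_one_sub_pow {t a : ℝ} (h0 : 0 ≤ t) (h1 : t ≤ 1) (ha0 : 0 ≤ a) (ha : a ≤ 1)
    (x : ℕ) : x * t - (x * t) ^ (1 + a) ≤ 1 - (1 - t) ^ x := by
  have hu : 0 ≤ x * t := by positivity
  rcases le_total 1 (x * t) with h | h
  · have h2 : (x * t) ^ (1 : ℝ) ≤ (x * t) ^ (1 + a) :=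
      Real.rpow_le_rpow_of_exponent_le h (by linarith)
    rw [Real.rpow_one] at h2
    have : (1 - t) ^ x ≤ 1 := pow_le_one₀ (by linarith) (by linarith)
    linarith
  · have h2 : (x * t) ^ (2 : ℝ) ≤ (x * t) ^ (1 + a) :=
      Real.rpow_le_rpow_of_exponent_ge' hu h (by linarith) (by linarith)
    rw [Real.rpow_two] at h2
    linarith [one_sub_pow_le h0 h1 x]

lemma one_sub_realPgf (p : PMF ℕ) {t : ℝ} (h0 : 0 ≤ t) (h1 : t ≤ 1) :
    1 - realPgf p (1 - t) = ∫ x, (1 - (1 - t) ^ x) ∂p.toMeasure := by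
  rw [integral_sub (integrable_const _) (integrable_pow p (by linarith) (by linarith))]
  simp [realPgf]

lemma mean_eq_integral {p : PMF ℕ} (hi : Integrable (fun x : ℕ => (x : ℝ)) p.toMeasure) :
    mean p = ∫ x, (x : ℝ) ∂p.toMeasure := by
  rw [PMF.integral_eq_tsum _ _ hi, mean]
  simp [mul_comm]

lemma one_sub_realPgf_le {p : PMF ℕ} (hi : Integrable (fun x : ℕ => (x : ℝ)) p.toMeasure)
    {t : ℝ} (h0 : 0 ≤ t) (h1 : t ≤ 1) : 1 - realPgf p (1 - t) ≤ mean p * t := by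
  rw [one_sub_realPgf p h0 h1, mean_eq_integral hi, ← integral_mul_const]
  refine integral_mono ((integrable_const _).sub (integrable_pow p (by linarith) (by linarith)))
    (hi.mul_const _) fun x => ?_
  have := one_add_mul_le_pow (a := -t) (by linarith) x
  simp only
  rw [← sub_eq_add_neg] at this
  linarith

lemma le_one_sub_realPgf {p : PMF ℕ} (hi : Integrable (fun x : ℕ => (x : ℝ)) p.toMeasure)
    {a : ℝ} (ha0 : 0 ≤ a) (ha : a ≤ 1)
    (hia : Integrable (fun x : ℕ => (x : ℝ) ^ (1 + a)) p.toMeasure)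
    {t : ℝ} (h0 : 0 ≤ t) (h1 : t ≤ 1) :
    mean p * t - (∫ x, (x : ℝ) ^ (1 + a) ∂p.toMeasure) * t ^ (1 + a) ≤ 1 - realPgf p (1 - t) := by
  rw [one_sub_realPgf p h0 h1, mean_eq_integral hi, ← integral_mul_const, ← integral_mul_const,
    ← integral_sub (hi.mul_const _) (hia.mul_const _)]
  refine integral_mono ((hi.mul_const _).sub (hia.mul_const _))
    ((integrable_const _).sub (integrable_pow p (by linarith) (by linarith))) fun x => ?_
  simp only
  rw [← Real.mul_rpow (by positivity) h0]
  exact sub_rpow_le_one_sub_pow h0 h1 ha0 ha x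

/-- Applied to `h t = 1 - f (1 - t)`, with `f` the generating function: `N` iterations carry a point
at distance `c / m ^ N` from `1` to distance at least `c / 2`. -/
lemma exists_le_iterate_of_le {h : ℝ → ℝ} {m M a : ℝ} (hm : 1 < m) (hM : 0 ≤ M) (ha : 0 < a)
    (h_mem : ∀ t, 0 ≤ t → t ≤ 1 → 0 ≤ h t ∧ h t ≤ 1)
    (h_le : ∀ t, 0 ≤ t → t ≤ 1 → h t ≤ m * t)
    (le_h : ∀ t, 0 ≤ t → t ≤ 1 → m * t - M * t ^ (1 + a) ≤ h t) :
    ∃ c, 0 < c ∧ c ≤ 1 / 2 ∧ ∀ N : ℕ, c / 2 ≤ h^[N] (c / m ^ N) := by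
  have hm0 : 0 < m := by linarith
  have hden : 0 < m ^ (1 + a) - m := by
    have := Real.rpow_lt_rpow_of_exponent_lt hm (show (1 : ℝ) < 1 + a by linarith)
    rw [Real.rpow_one] at this
    linarith
  set D := M / (m ^ (1 + a) - m) with hD
  have hD0 : 0 ≤ D := by positivity
  -- `D` is the fixed point that lets the lower bound `u - D * u ^ (1 + a)` reproduce itself under
  -- `u ↦ m * u`.
  have hDM : m * D + M = D * m ^ (1 + a) := by
    rw [hD]; field_simp; ring
  have hlim : Tendsto (fun c : ℝ => D * c ^ a) (𝓝[>] 0) (𝓝 0) := by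
    have : Tendsto (fun c : ℝ => D * c ^ a) (𝓝 0) (𝓝 (D * 0 ^ a)) :=
      (Real.continuousAt_rpow_const 0 a (Or.inr ha.le)).tendsto.const_mul D
    rw [Real.zero_rpow ha.ne', mul_zero] at this
    exact this.mono_left nhdsWithin_le_nhds
  -- `D * c ^ a < 1 / 2` makes the final bound `c - D * c ^ (1 + a)` at least `c / 2`.
  obtain ⟨c, hc1, hc2, hc0⟩ := ((hlim.eventually_lt_const (show (0 : ℝ) < 1 / 2 by norm_num)).and
    ((tendsto_nhdsWithin_of_tendsto_nhds tendsto_id).eventually_lt_const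
      (show (0 : ℝ) < 1 / 2 by norm_num) |>.and self_mem_nhdsWithin)).exists
  simp only [id] at hc2 hc0
  refine ⟨c, hc0, hc2.le, fun N => ?_⟩
  have ht0 : 0 < c / m ^ N := by positivity
  have ht1 : c / m ^ N ≤ 1 := by
    rw [div_le_one (by positivity)]
    have := one_le_pow₀ (n := N) hm.le
    linarith
  have key (j : ℕ) : (0 ≤ h^[j] (c / m ^ N) ∧ h^[j] (c / m ^ N) ≤ 1) ∧
      h^[j] (c / m ^ N) ≤ m ^ j * (c / m ^ N) ∧
      m ^ j * (c / m ^ N) - D * (m ^ j * (c / m ^ N)) ^ (1 + a) ≤ h^[j] (c / m ^ N) := by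
    induction j with
    | zero =>
      refine ⟨⟨ht0.le, ht1⟩, by simp, ?_⟩
      have : 0 ≤ D * (c / m ^ N) ^ (1 + a) := by positivity
      simpa using this
    | succ j ih =>
      obtain ⟨⟨i0, i1⟩, i2, i3⟩ := ih
      rw [Function.iterate_succ_apply']
      set u := m ^ j * (c / m ^ N) with hu
      have hu0 : 0 ≤ u := by positivity
      set y := h^[j] (c / m ^ N)
      have e : m ^ (j + 1) * (c / m ^ N) = m * u := by rw [hu]; ring
      rw [e, Real.mul_rpow hm0.le hu0]
      refine ⟨h_mem y i0 i1, (h_le y i0 i1).trans (mul_le_mul_of_nonneg_left i2 hm0.le), ?_⟩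
      have h5 : y ^ (1 + a) ≤ u ^ (1 + a) := Real.rpow_le_rpow i0 i2 (by linarith)
      calc m * u - D * (m ^ (1 + a) * u ^ (1 + a))
          = m * (u - D * u ^ (1 + a)) - M * u ^ (1 + a) := by
            linear_combination (u ^ (1 + a)) * hDM
        _ ≤ m * y - M * y ^ (1 + a) := by gcongr
        _ ≤ h y := le_h y i0 i1
  have h6 := (key N).2.2
  have e : m ^ N * (c / m ^ N) = c := by field_simp
  rw [e, Real.rpow_add hc0, Real.rpow_one] at h6
  nlinarith

lemma iterate_one_sub (f : ℝ → ℝ) (n : ℕ) (t : ℝ) :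
    (fun t => 1 - f (1 - t))^[n] t = 1 - f^[n] (1 - t) := by
  induction n generalizing t with
  | zero => simp
  | succ n ih => rw [Function.iterate_succ_apply, ih, Function.iterate_succ_apply]; simp

/-! ### Growth of the partial sums of the rescaled laws. -/

/-- Moment and normalization conditions on an offspring law under which the Schröder-scaled
generation laws have power-bounded partial sums. -/
structure IsRegular (p : PMF ℕ) (a : ℝ) : Prop where
  zero : p 0 = 0
  one_pos : 0 < (p 1).toReal
  one_lt : (p 1).toReal < 1
  one_lt_mean : 1 < mean p
  exponent_pos : 0 < a
  exponent_lt : a < 1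
  integrable : Integrable (fun x : ℕ => (x : ℝ)) p.toMeasure
  integrable_rpow : Integrable (fun x : ℕ => (x : ℝ) ^ (1 + a)) p.toMeasure

/-- The generation law rescaled by `p₁ ^ n`. -/
noncomputable def scaledLaw (p : PMF ℕ) (n k : ℕ) : ℝ :=
  (genLaw p n 1 k).toReal / (p 1).toReal ^ n

lemma scaledLaw_nonneg (p : PMF ℕ) (n k : ℕ) : 0 ≤ scaledLaw p n k := by
  unfold scaledLaw; positivity

lemma scaledLaw_monotone {p : PMF ℕ} (h1 : 0 < (p 1).toReal) (k : ℕ) :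
    Monotone fun n => scaledLaw p n k := by
  refine monotone_nat_of_le_succ fun n => ?_
  have h := ENNReal.toReal_mono (PMF.apply_ne_top _ _) (mul_genLaw_le_genLaw_succ p n k)
  rw [ENNReal.toReal_mul] at h
  rw [scaledLaw, scaledLaw, div_le_div_iff₀ (by positivity) (by positivity), pow_succ]
  have : 0 ≤ (p 1).toReal ^ n := by positivity
  nlinarith

lemma IsRegular.exists_sum_scaledLaw_le {p : PMF ℕ} {a : ℝ} (h : IsRegular p a) :
    ∃ B, 0 ≤ B ∧ ∀ (n N : ℕ) (A : Finset ℕ), (∀ k ∈ A, (k : ℝ) ≤ mean p ^ N) →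
      ∑ k ∈ A, scaledLaw p n k ≤ B / (p 1).toReal ^ N := by
  have hp1 := h.one_pos
  set m := mean p with hmdef
  have hm0 : 0 < m := by linarith [h.one_lt_mean]
  obtain ⟨c, hc0, hc1, hc⟩ := exists_le_iterate_of_le (h := fun t => 1 - realPgf p (1 - t))
    (m := m) (M := ∫ x, (x : ℝ) ^ (1 + a) ∂p.toMeasure) (a := a) h.one_lt_mean
    (integral_nonneg fun x => by positivity) h.exponent_pos
    (fun t h0 h1 => by
      have := realPgf_nonneg p (s := 1 - t) (by linarith)
      have := realPgf_le_one p (s := 1 - t) (by linarith) (by linarith)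
      constructor <;> linarith)
    (fun t h0 h1 => one_sub_realPgf_le h.integrable h0 h1)
    (fun t h0 h1 => le_one_sub_realPgf h.integrable h.exponent_pos.le h.exponent_lt.le
      h.integrable_rpow h0 h1)
  obtain ⟨B, hB⟩ := exists_iterate_le_mul_pow h.one_pos h.one_lt
    (fun s h0 _ => realPgf_nonneg p h0) (fun s h0 h1 => realPgf_le p h.zero h0 h1)
    (s := 1 - c / 2) (by linarith) (by linarith)
  have hB0 : 0 ≤ B := by
    have := hB 0
    simp only [Function.iterate_zero, id, pow_zero, mul_one] at this
    linarith
  refine ⟨2 * B, by positivity, fun n N A hA => ?_⟩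
  set t := c / m ^ N with ht
  have ht0 : 0 ≤ t := by positivity
  have ht1 : t ≤ 1 := by
    rw [ht, div_le_one (by positivity)]
    have := one_le_pow₀ (n := N) h.one_lt_mean.le
    linarith
  -- By Bernoulli the weight is at least `1 - c` for `k ≤ m ^ N`, so inserting it costs a factor
  -- `2`.
  have hpow (k : ℕ) (hk : k ∈ A) : 1 / 2 ≤ (1 - t) ^ k := by
    have h1 := one_add_mul_le_pow (a := -t) (by linarith) k
    have h2 : k * t ≤ m ^ N * t := mul_le_mul_of_nonneg_right (hA k hk) ht0
    have h3 : m ^ N * t = c := by rw [ht]; field_simp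
    rw [← sub_eq_add_neg] at h1
    linarith
  have hmain : (realPgf p)^[N + n] (1 - t) ≤ B * (p 1).toReal ^ n := by
    rw [add_comm, Function.iterate_add_apply]
    have h1 := hc N
    rw [iterate_one_sub] at h1
    refine (realPgf_iterate_mono p (realPgf_iterate_mem p (by linarith) (by linarith) N).1
      (t := 1 - c / 2) (by linarith) (by linarith) n).trans (hB n)
  -- Monotonicity allows time `N + n` in place of `n`: `N` iterations bring `1 - t` below `1 - c /
  -- 2`, and the other `n` produce the decay `p₁ ^ n`.
  calc ∑ k ∈ A, scaledLaw p n k ≤ ∑ k ∈ A, scaledLaw p (N + n) k :=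
        Finset.sum_le_sum fun k _ => scaledLaw_monotone hp1 k (by omega)
    _ ≤ ∑ k ∈ A, 2 * ((genLaw p (N + n) 1 k).toReal * (1 - t) ^ k) / (p 1).toReal ^ (N + n) := by
        refine Finset.sum_le_sum fun k hk => ?_
        rw [scaledLaw]
        gcongr
        have := hpow k hk
        have h0 : 0 ≤ (genLaw p (N + n) 1 k).toReal := by positivity
        nlinarith
    _ = 2 * (∑ k ∈ A, (genLaw p (N + n) 1 k).toReal * (1 - t) ^ k) / (p 1).toReal ^ (N + n) := by
        rw [← Finset.sum_div, ← Finset.mul_sum]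
    _ ≤ 2 * (B * (p 1).toReal ^ n) / (p 1).toReal ^ (N + n) := by
        gcongr
        exact (sum_genLaw_mul_pow_le p (by linarith) (by linarith) _ A).trans hmain
    _ = 2 * B / (p 1).toReal ^ N := by
        rw [pow_add]; field_simp

/-! ### Deviation probabilities and the truncated second moment. -/

/-- The truncated second moment `E[min(u, ξ² / u)]`. -/
noncomputable def truncMoment (p : PMF ℕ) (u : ℝ) : ℝ :=
  ∫ x, min u ((x : ℝ) ^ 2 / u) ∂p.toMeasure

lemma integrable_min (p : PMF ℕ) {u : ℝ} (hu : 0 ≤ u) :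
    Integrable (fun x : ℕ => min u ((x : ℝ) ^ 2 / u)) p.toMeasure :=
  integrable_of_abs_le p _ u fun x => by
    rw [abs_of_nonneg (le_min hu (by positivity))]
    exact min_le_left _ _

lemma truncMoment_nonneg (p : PMF ℕ) {u : ℝ} (hu : 0 ≤ u) : 0 ≤ truncMoment p u :=
  integral_nonneg fun x => le_min hu (by positivity)

lemma meanDeviation_nonneg (p : PMF ℕ) (k : ℕ) (ε : ℝ) : 0 ≤ meanDeviation p k ε :=
  measureReal_nonneg

/-- The identity on `ℕ` cut off above `k`. -/
noncomputable def cutoff (k : ℕ) (x : ℕ) : ℝ := if x ≤ k then (x : ℝ) else 0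

lemma cutoff_nonneg (k x : ℕ) : 0 ≤ cutoff k x := by
  unfold cutoff; split_ifs <;> positivity

lemma cutoff_le (k x : ℕ) : cutoff k x ≤ k := by
  unfold cutoff; split_ifs with h
  · exact_mod_cast h
  · positivity

lemma memLp_cutoff (p : PMF ℕ) (k : ℕ) : MemLp (cutoff k) 2 p.toMeasure :=
  MemLp.of_bound Measurable.of_discrete.aestronglyMeasurable k
    (Eventually.of_forall fun x => by
      rw [Real.norm_eq_abs, abs_of_nonneg (cutoff_nonneg k x)]
      exact cutoff_le k x)

lemma tendsto_integral_cutoff {p : PMF ℕ}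
    (hi : Integrable (fun x : ℕ => (x : ℝ)) p.toMeasure) :
    Tendsto (fun k => ∫ x, cutoff k x ∂p.toMeasure) atTop (𝓝 (mean p)) := by
  rw [mean_eq_integral hi]
  refine tendsto_integral_of_dominated_convergence (fun x : ℕ => (x : ℝ))
    (fun k => Measurable.of_discrete.aestronglyMeasurable) hi
    (fun k => Eventually.of_forall fun x => ?_) (Eventually.of_forall fun x => ?_)
  · rw [Real.norm_eq_abs, abs_of_nonneg (cutoff_nonneg k x)]
    unfold cutoff; split_ifs
    · rfl
    · positivity
  · refine tendsto_const_nhds.congr' ?_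
    filter_upwards [eventually_ge_atTop x] with k hk
    simp [cutoff, hk]

lemma measureReal_cutoff_le (p : PMF ℕ) {k : ℕ} (hk : 0 < k) {c : ℝ} (hc : 0 < c) :
    (Measure.pi (fun _ : Fin k => p.toMeasure)).real
      {x | k * c ≤ |∑ i, cutoff k (x i) - k * ∫ x, cutoff k x ∂p.toMeasure|} ≤
      (∫ x, cutoff k x ^ 2 ∂p.toMeasure) / (k * c ^ 2) := by
  set P := Measure.pi (fun _ : Fin k => p.toMeasure)
  have hm (i : Fin k) : MemLp (fun x : Fin k → ℕ => cutoff k (x i)) 2 P :=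
    (memLp_cutoff p k).comp_measurePreserving (measurePreserving_eval _ i)
  have hX : MemLp (∑ i : Fin k, fun x : Fin k → ℕ => cutoff k (x i)) 2 P :=
    memLp_finsetSum' _ fun i _ => hm i
  have hE : P[∑ i : Fin k, fun x : Fin k → ℕ => cutoff k (x i)] =
      k * ∫ x, cutoff k x ∂p.toMeasure := by
    simp_rw [Finset.sum_apply]
    rw [integral_finsetSum _ fun i _ => (hm i).integrable one_le_two]
    have (i : Fin k) : ∫ x, cutoff k (x i) ∂P = ∫ x, cutoff k x ∂p.toMeasure :=
      integral_comp_eval (μ := fun _ : Fin k => p.toMeasure) (f := cutoff k)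
        Measurable.of_discrete.aestronglyMeasurable
    simp [this]
  have hV : variance (∑ i : Fin k, fun x : Fin k → ℕ => cutoff k (x i)) P ≤
      k * ∫ x, cutoff k x ^ 2 ∂p.toMeasure := by
    rw [variance_sum_pi (μ := fun _ : Fin k => p.toMeasure) fun _ => memLp_cutoff p k]
    have : variance (cutoff k) p.toMeasure ≤ ∫ x, cutoff k x ^ 2 ∂p.toMeasure :=
      variance_le_expectation_sq Measurable.of_discrete.aestronglyMeasurable
    simpa using mul_le_mul_of_nonneg_left this (Nat.cast_nonneg k)
  have hk' : (0 : ℝ) < k := by exact_mod_cast hk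
  have h := meas_ge_le_variance_div_sq hX (c := k * c) (by positivity)
  rw [hE] at h
  have h2 := ENNReal.toReal_mono ENNReal.ofReal_ne_top h
  rw [ENNReal.toReal_ofReal (div_nonneg (variance_nonneg _ _) (by positivity))] at h2
  simp only [Finset.sum_apply] at h2
  refine h2.trans ?_
  calc _ ≤ (k * ∫ x, cutoff k x ^ 2 ∂p.toMeasure) / (k * c) ^ 2 := by gcongr
    _ = _ := by field_simp

lemma meanDeviation_le (p : PMF ℕ) {k : ℕ} (hk : 0 < k) {ε : ℝ} (hε : 0 < ε)
    (hcut : |∫ x, cutoff k x ∂p.toMeasure - mean p| ≤ ε / 2) :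
    meanDeviation p k ε ≤ (1 + 4 / ε ^ 2) * truncMoment p k := by
  set P := Measure.pi (fun _ : Fin k => p.toMeasure) with hP
  set e := ∫ x, cutoff k x ∂p.toMeasure
  have hk' : (0 : ℝ) < k := by exact_mod_cast hk
  -- If no variable exceeds `k`, the sum equals its truncation, and recentring at the truncated mean
  -- costs at most `ε / 2`.
  have hsub : {x : Fin k → ℕ | ε ≤ |(1 / (k : ℝ)) * (∑ i, (x i : ℝ)) - mean p|} ⊆
      (⋃ i : Fin k, {x | k < x i}) ∪ {x | k * (ε / 2) ≤ |∑ i, cutoff k (x i) - k * e|} := by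
    intro x hx
    by_cases hb : ∃ i, k < x i
    · exact Or.inl (Set.mem_iUnion.2 hb)
    · push Not at hb
      right
      simp only [Set.mem_ofPred_eq] at hx ⊢
      have hs : ∑ i, cutoff k (x i) = ∑ i, (x i : ℝ) :=
        Finset.sum_congr rfl fun i _ => by simp [cutoff, hb i]
      rw [hs]
      have e1 : ∑ i, (x i : ℝ) - k * e = k * ((1 / (k : ℝ)) * (∑ i, (x i : ℝ)) - e) := by
        field_simp
      rw [e1, abs_mul, abs_of_pos hk']
      gcongr
      have := abs_sub_le ((1 / (k : ℝ)) * (∑ i, (x i : ℝ))) e (mean p)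
      linarith
  have htail : P.real (⋃ i : Fin k, {x | k < x i}) ≤ k * p.toMeasure.real {x | k < x} := by
    refine (measureReal_iUnion_fintype_le _).trans ?_
    have (i : Fin k) : P.real {x | k < x i} = p.toMeasure.real {x | k < x} := by
      rw [measureReal_def, measureReal_def,
        ← (measurePreserving_eval (fun _ : Fin k => p.toMeasure) i).measure_preimage
          (s := {x | k < x}) (Set.to_countable _).measurableSet.nullMeasurableSet]
      rfl
    simp [this]
  have hi1 : Integrable (({x : ℕ | k < x}).indicator fun _ => (k : ℝ)) p.toMeasure :=
    (integrable_const _).indicator (Set.to_countable _).measurableSet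
  have hi2 : Integrable (fun x => cutoff k x ^ 2) p.toMeasure := (memLp_cutoff p k).integrable_sq
  -- The union bound and the Chebyshev term are exactly the two branches of `min k (x ^ 2 / k)`.
  have htr : truncMoment p k = k * p.toMeasure.real {x | k < x} +
      (∫ x, cutoff k x ^ 2 ∂p.toMeasure) / k := by
    rw [← integral_div, mul_comm, ← smul_eq_mul,
      ← integral_indicator_const _ (Set.to_countable _).measurableSet,
      ← integral_add hi1 (hi2.div_const _), truncMoment]
    congr with x
    by_cases hx : x ≤ k
    · have hx' : (x : ℝ) ≤ k := by exact_mod_cast hx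
      have : (x : ℝ) ^ 2 / k ≤ k := by
        rw [div_le_iff₀ hk']
        nlinarith [(Nat.cast_nonneg x : (0 : ℝ) ≤ x)]
      simp [cutoff, hx, not_lt.2 hx, this]
    · have hx' : (k : ℝ) ≤ x := by exact_mod_cast (not_le.1 hx).le
      have : (k : ℝ) ≤ (x : ℝ) ^ 2 / k := by
        rw [le_div_iff₀ hk']
        nlinarith
      simp [cutoff, hx, not_le.1 hx, this]
  calc meanDeviation p k ε
      ≤ P.real (⋃ i : Fin k, {x | k < x i}) +
        P.real {x | k * (ε / 2) ≤ |∑ i, cutoff k (x i) - k * e|} :=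
        (measureReal_mono hsub).trans (measureReal_union_le _ _)
    _ ≤ k * p.toMeasure.real {x | k < x} +
        (∫ x, cutoff k x ^ 2 ∂p.toMeasure) / (k * (ε / 2) ^ 2) :=
        add_le_add htail (measureReal_cutoff_le p hk (by positivity))
    _ ≤ (1 + 4 / ε ^ 2) * truncMoment p k := by
        have e1 : (∫ x, cutoff k x ^ 2 ∂p.toMeasure) / (k * (ε / 2) ^ 2) =
          4 / ε ^ 2 * ((∫ x, cutoff k x ^ 2 ∂p.toMeasure) / k) := by field_simp; ring
        have e2 : 0 ≤ (∫ x, cutoff k x ^ 2 ∂p.toMeasure) / k :=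
          div_nonneg (integral_nonneg fun x => sq_nonneg _) hk'.le
        have e3 : 0 ≤ 4 / ε ^ 2 * (k * p.toMeasure.real {x | k < x}) := by positivity
        rw [htr, e1]
        linarith

/-! ### Summation over powers of the mean. -/

lemma sum_pow_mul_min_le {m a : ℝ} (hm : 1 < m) (ha0 : 0 < a) (ha1 : a < 1) {x : ℝ} (hx : 1 ≤ x)
    (M : ℕ) :
    ∑ N ∈ Finset.range M, (m ^ a) ^ N * min (m ^ N) (x ^ 2 / m ^ N) ≤
      (m ^ (1 + a) / (m ^ (1 + a) - 1) + 1 / (1 - m ^ (a - 1))) * x ^ (1 + a) := by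
  have hm0 : 0 < m := by linarith
  have hx0 : 0 < x := by linarith
  -- Split where `m ^ n ≤ x < m ^ (n + 1)`: up to `n` the terms are bounded by a geometric sum of
  -- ratio `R > 1`, beyond it by one of ratio `ρ < 1`. The latter needs `a < 1`.
  obtain ⟨n, hn1, hn2⟩ := exists_nat_pow_near hx hm
  set R := m ^ (1 + a) with hR
  set ρ := m ^ (a - 1) with hρ
  have hR1 : 1 < R := Real.one_lt_rpow hm (by linarith)
  have hρ0 : 0 < ρ := by positivity
  have hρ1 : ρ < 1 := Real.rpow_lt_one_of_one_lt_of_neg hm (by linarith)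
  have hRm : m ^ a * m = R := by rw [hR, add_comm, Real.rpow_add hm0, Real.rpow_one]
  have hρm : m ^ a / m = ρ := by rw [hρ, Real.rpow_sub hm0, Real.rpow_one]
  set f : ℕ → ℝ := fun N => (m ^ a) ^ N * min (m ^ N) (x ^ 2 / m ^ N)
  have hf0 (N : ℕ) : 0 ≤ f N := mul_nonneg (by positivity) (le_min (by positivity) (by positivity))
  have hf1 (N : ℕ) : f N ≤ R ^ N := by
    rw [← hRm, mul_pow]
    exact mul_le_mul_of_nonneg_left (min_le_left _ _) (by positivity)
  have hf2 (N : ℕ) : f N ≤ x ^ 2 * ρ ^ N := by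
    rw [← hρm, div_pow]
    refine (mul_le_mul_of_nonneg_left (min_le_right _ _) (by positivity)).trans_eq ?_
    ring
  have h1 : ∑ N ∈ Finset.range (n + 1), f N ≤ R / (R - 1) * x ^ (1 + a) := by
    calc ∑ N ∈ Finset.range (n + 1), f N ≤ ∑ N ∈ Finset.range (n + 1), R ^ N :=
          Finset.sum_le_sum fun N _ => hf1 N
      _ = (R ^ (n + 1) - 1) / (R - 1) := geom_sum_eq hR1.ne' _
      _ ≤ R * R ^ n / (R - 1) := by
          have : 0 < R - 1 := by linarith
          gcongr
          rw [pow_succ]; linarith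
      _ ≤ R * x ^ (1 + a) / (R - 1) := by
          have : 0 < R - 1 := by linarith
          gcongr
          rw [hR, ← Real.rpow_mul_natCast hm0.le, mul_comm, Real.rpow_natCast_mul hm0.le]
          exact Real.rpow_le_rpow (by positivity) hn1 (by linarith)
      _ = _ := by ring
  have h2 : ∑ i ∈ Finset.range M, f (n + 1 + i) ≤ 1 / (1 - ρ) * x ^ (1 + a) := by
    have hxx : x ^ 2 * ρ ^ (n + 1) ≤ x ^ (1 + a) := by
      have : ρ ^ (n + 1) ≤ x ^ (a - 1) := by
        rw [hρ, ← Real.rpow_mul_natCast hm0.le, mul_comm, Real.rpow_natCast_mul hm0.le]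
        exact Real.rpow_le_rpow_of_nonpos hx0 hn2.le (by linarith)
      calc x ^ 2 * ρ ^ (n + 1) ≤ x ^ 2 * x ^ (a - 1) := by gcongr
        _ = x ^ (1 + a) := by
          rw [← Real.rpow_two, ← Real.rpow_add hx0]; congr 1; ring
    calc ∑ i ∈ Finset.range M, f (n + 1 + i)
        ≤ ∑ i ∈ Finset.range M, x ^ (1 + a) * ρ ^ i := by
          refine Finset.sum_le_sum fun i _ => (hf2 _).trans ?_
          rw [pow_add, ← mul_assoc]
          gcongr
      _ = x ^ (1 + a) * ∑ i ∈ Finset.range M, ρ ^ i := by rw [Finset.mul_sum]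
      _ ≤ x ^ (1 + a) * (1 - ρ)⁻¹ := by
          gcongr
          rw [← tsum_geometric_of_lt_one hρ0.le hρ1]
          exact (summable_geometric_of_lt_one hρ0.le hρ1).sum_le_tsum _ fun i _ => by positivity
      _ = _ := by ring
  calc ∑ N ∈ Finset.range M, f N ≤ ∑ N ∈ Finset.range (n + 1 + M), f N :=
        Finset.sum_le_sum_of_subset_of_nonneg (Finset.range_mono (by omega)) fun i _ _ => hf0 i
    _ = ∑ N ∈ Finset.range (n + 1), f N + ∑ i ∈ Finset.range M, f (n + 1 + i) :=
        Finset.sum_range_add _ _ _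
    _ ≤ _ := by rw [add_mul]; exact add_le_add h1 h2

lemma IsRegular.exists_sum_truncMoment_le {p : PMF ℕ} {a : ℝ} (h : IsRegular p a) :
    ∃ C, ∀ M : ℕ, ∑ N ∈ Finset.range M, (mean p ^ a) ^ N * truncMoment p (mean p ^ N) ≤ C := by
  have hm0 : 0 < mean p := by linarith [h.one_lt_mean]
  refine ⟨∫ x, (mean p ^ (1 + a) / (mean p ^ (1 + a) - 1) + 1 / (1 - mean p ^ (a - 1))) *
    (x : ℝ) ^ (1 + a) ∂p.toMeasure, fun M => ?_⟩
  have hi (N : ℕ) := (integrable_min p (u := mean p ^ N) (by positivity)).const_mul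
    ((mean p ^ a) ^ N)
  simp_rw [truncMoment, ← integral_const_mul]
  rw [← integral_finsetSum _ fun N _ => hi N]
  refine integral_mono_ae (integrable_finsetSum _ fun N _ => hi N)
    (h.integrable_rpow.const_mul _) ?_
  filter_upwards [ae_one_le h.zero] with x hx
  exact sum_pow_mul_min_le h.one_lt_mean h.exponent_pos h.exponent_lt (by exact_mod_cast hx) M

lemma truncMoment_le_mul (p : PMF ℕ) {u v m : ℝ} (hu : 0 < u) (huv : u ≤ v) (hvu : v ≤ m * u)
    (hm : 1 ≤ m) : truncMoment p u ≤ m * truncMoment p v := by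
  have hv : 0 < v := hu.trans_le huv
  rw [truncMoment, truncMoment, ← integral_const_mul]
  refine integral_mono (integrable_min p hu.le) ((integrable_min p hv.le).const_mul m) fun x => ?_
  simp only
  rw [mul_min_of_nonneg _ _ (by linarith)]
  refine min_le_min (by nlinarith) ?_
  rw [← mul_div_assoc, div_le_div_iff₀ hu hv]
  nlinarith [sq_nonneg (x : ℝ)]

lemma IsRegular.summable_mul_truncMoment {p : PMF ℕ} {a : ℝ} (h : IsRegular p a)
    (ha : mean p ^ a * (p 1).toReal = 1) {q : ℕ → ℝ} (hq : ∀ k, 0 ≤ q k) {B : ℝ} (hB : 0 ≤ B)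
    (hqB : ∀ (N : ℕ) (A : Finset ℕ), (∀ k ∈ A, (k : ℝ) ≤ mean p ^ N) →
      ∑ k ∈ A, q k ≤ B / (p 1).toReal ^ N) :
    Summable fun k : ℕ => q (k + 1) * truncMoment p ((k + 1 : ℕ) : ℝ) := by
  set m := mean p with hmdef
  have hm := h.one_lt_mean
  rw [← hmdef] at hm
  have hm0 : 0 < m := by linarith
  obtain ⟨C, hC⟩ := h.exists_sum_truncMoment_le
  -- Rounding `k + 1` up to a power of `m` changes `truncMoment` by a factor at most `m`.
  have hN (k : ℕ) : ∃ N : ℕ, ((k + 1 : ℕ) : ℝ) ≤ m ^ N ∧ m ^ N ≤ m * ((k + 1 : ℕ) : ℝ) := by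
    obtain ⟨n, hn1, hn2⟩ := exists_nat_pow_near (x := ((k + 1 : ℕ) : ℝ)) (by simp) hm
    exact ⟨n + 1, hn2.le, by rw [pow_succ']; gcongr⟩
  choose N hN1 hN2 using hN
  refine summable_of_sum_le (c := m * B * C)
    (fun k => mul_nonneg (hq _) (truncMoment_nonneg p (by positivity))) fun A => ?_
  set M := A.sup N + 1
  have hT (n : ℕ) : 0 ≤ truncMoment p (m ^ n) := truncMoment_nonneg p (by positivity)
  calc ∑ k ∈ A, q (k + 1) * truncMoment p ((k + 1 : ℕ) : ℝ)
      ≤ ∑ k ∈ A, q (k + 1) * (m * truncMoment p (m ^ N k)) := by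
        refine Finset.sum_le_sum fun k _ => mul_le_mul_of_nonneg_left ?_ (hq _)
        exact truncMoment_le_mul p (by positivity) (hN1 k) (hN2 k) hm.le
    _ = ∑ n ∈ Finset.range M, ∑ k ∈ A with N k = n, q (k + 1) * (m * truncMoment p (m ^ N k)) :=
        (Finset.sum_fiberwise_of_maps_to (fun k hk => Finset.mem_range.2
          (Nat.lt_succ_of_le (Finset.le_sup hk))) _).symm
    _ ≤ ∑ n ∈ Finset.range M, m * B * ((m ^ a) ^ n * truncMoment p (m ^ n)) := by
        refine Finset.sum_le_sum fun n _ => ?_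
        have e : ∑ k ∈ A with N k = n, q (k + 1) * (m * truncMoment p (m ^ N k)) =
            (∑ k ∈ (A.filter (N · = n)).map ⟨_, Nat.succ_injective⟩, q k) *
              (m * truncMoment p (m ^ n)) := by
          rw [Finset.sum_map, Finset.sum_mul]
          refine Finset.sum_congr rfl fun k hk => ?_
          rw [(Finset.mem_filter.1 hk).2]
          rfl
        have hb := hqB n ((A.filter (N · = n)).map ⟨_, Nat.succ_injective⟩) (by
          intro k hk
          obtain ⟨j, hj, rfl⟩ := Finset.mem_map.1 hk
          have := hN1 j
          rw [(Finset.mem_filter.1 hj).2] at this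
          exact this)
        have hpn : B / (p 1).toReal ^ n = B * (m ^ a) ^ n := by
          have hp := h.one_pos
          rw [div_eq_iff (by positivity), mul_assoc, ← mul_pow, ha, one_pow, mul_one]
        rw [e]
        rw [hpn] at hb
        calc _ ≤ (B * (m ^ a) ^ n) * (m * truncMoment p (m ^ n)) :=
              mul_le_mul_of_nonneg_right hb (mul_nonneg hm0.le (hT n))
          _ = _ := by ring
    _ ≤ m * B * C := by
        rw [← Finset.mul_sum]
        exact mul_le_mul_of_nonneg_left (hC M) (by positivity)

/-! ### Convergence of the rescaled deviation probabilities. -/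

lemma genLaw_zero {p : PMF ℕ} (hp0 : p 0 = 0) (n : ℕ) : genLaw p n 1 0 = 0 := by
  induction n with
  | zero => simp [genLaw, PMF.pure_apply]
  | succ n ih =>
    rw [genLaw, PMF.bind_apply, ENNReal.tsum_eq_zero]
    intro j
    rcases j.eq_zero_or_pos with rfl | hj
    · simp [ih]
    · have hs : sumLaw p j 0 = 0 := by
        have h := pgf_sumLaw p j 0
        have h0 (r : PMF ℕ) : pgf r 0 = r 0 := by
          rw [pgf, tsum_eq_single 0 fun k hk => by simp [hk]]
          simp
        rw [h0, h0, hp0, zero_pow hj.ne'] at h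
        exact h
      simp [hs]

/-- Under the moment conditions the rescaled generation laws converge pointwise, and so do their
integrals against the deviation probabilities. -/
theorem IsRegular.tendsto_deviation {p : PMF ℕ} {a : ℝ} (h : IsRegular p a)
    (ha : mean p ^ a * (p 1).toReal = 1) :
    ∃ q : ℕ → ℝ, (∀ k, Tendsto (fun n => scaledLaw p n k) atTop (𝓝 (q k))) ∧
      ∀ ε : ℝ, 0 < ε →
        Summable (fun k : ℕ => q (k + 1) * meanDeviation p (k + 1) ε) ∧
        Tendsto (fun n => ∑' k, scaledLaw p n k * meanDeviation p k ε) atTop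
          (𝓝 (∑' k : ℕ, q (k + 1) * meanDeviation p (k + 1) ε)) := by
  obtain ⟨B, hB0, hB⟩ := h.exists_sum_scaledLaw_le
  have hbdd (k : ℕ) : BddAbove (Set.range fun n => scaledLaw p n k) := by
    obtain ⟨N, hN⟩ := pow_unbounded_of_one_lt (k : ℝ) h.one_lt_mean
    refine ⟨B / (p 1).toReal ^ N, ?_⟩
    rintro _ ⟨n, rfl⟩
    simpa using hB n N {k} (by simpa using hN.le)
  set q : ℕ → ℝ := fun k => ⨆ n, scaledLaw p n k
  have hq (k : ℕ) : Tendsto (fun n => scaledLaw p n k) atTop (𝓝 (q k)) :=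
    tendsto_atTop_ciSup (scaledLaw_monotone h.one_pos k) (hbdd k)
  have hle (n k : ℕ) : scaledLaw p n k ≤ q k := le_ciSup (hbdd k) n
  have hq0 (k : ℕ) : 0 ≤ q k := (scaledLaw_nonneg p 0 k).trans (hle 0 k)
  have hzero (n : ℕ) : scaledLaw p n 0 = 0 := by simp [scaledLaw, genLaw_zero h.zero]
  have hqzero : q 0 = 0 := tendsto_nhds_unique (hq 0) (by simp [hzero])
  refine ⟨q, hq, fun ε hε => ?_⟩
  have hs : Summable fun k : ℕ => q (k + 1) * meanDeviation p (k + 1) ε := by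
    have ht := h.summable_mul_truncMoment ha hq0 hB0 fun N A hA =>
      le_of_tendsto' (tendsto_finsetSum A fun k _ => hq k) fun n => hB n N A hA
    -- The bound on `meanDeviation` needs the truncated mean within `ε / 2` of `m`, which holds for
    -- large `k`; finitely many terms are discarded.
    obtain ⟨k₀, hk₀⟩ := eventually_atTop.1
      ((tendsto_integral_cutoff h.integrable).eventually
        (Metric.closedBall_mem_nhds _ (half_pos hε)))
    rw [← summable_nat_add_iff k₀]
    refine Summable.of_nonneg_of_le
      (fun k => mul_nonneg (hq0 _) (meanDeviation_nonneg p _ ε)) (fun k => ?_)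
      (((summable_nat_add_iff k₀).2 ht).mul_left (1 + 4 / ε ^ 2))
    rw [mul_left_comm]
    refine mul_le_mul_of_nonneg_left (meanDeviation_le p (by omega) hε ?_) (hq0 _)
    simpa [Real.dist_eq] using hk₀ (k + k₀ + 1) (by omega)
  have hs' : Summable fun k : ℕ => q k * meanDeviation p k ε := (summable_nat_add_iff 1).1 hs
  refine ⟨hs, ?_⟩
  have hlim : ∑' k : ℕ, q (k + 1) * meanDeviation p (k + 1) ε =
      ∑' k : ℕ, q k * meanDeviation p k ε := by
    rw [hs'.tsum_eq_zero_add, hqzero]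
    simp
  rw [hlim]
  -- The limiting series itself is the dominating one, by monotonicity in `n`.
  refine tendsto_tsum_of_dominated_convergence hs' (fun k => (hq k).mul_const _)
    (Eventually.of_forall fun n k => ?_)
  rw [Real.norm_eq_abs, abs_of_nonneg (mul_nonneg (scaledLaw_nonneg p n k)
    (meanDeviation_nonneg p k ε))]
  exact mul_le_mul_of_nonneg_right (hle n k) (meanDeviation_nonneg p k ε)

/-! ### Moments of a law with regularly varying tail. -/

/-- The tail of an offspring law. -/
noncomputable def tail (p : PMF ℕ) (x : ℝ) : ℝ := p.toMeasure.real {k | x < (k : ℝ)}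

lemma tail_nonneg (p : PMF ℕ) (x : ℝ) : 0 ≤ tail p x := measureReal_nonneg

lemma eventually_tail_ne_zero {p : PMF ℕ} {β : ℝ} {L : ℝ → ℝ} (hL : IsSlowlyVarying L)
    (h : tail p ~[atTop] fun x => x ^ (-β) * L x) : ∀ᶠ x in atTop, tail p x ≠ 0 := by
  obtain ⟨b, hb, -⟩ := hL.pos_measurable
  have hv : ∀ᶠ x : ℝ in atTop, x ^ (-β) * L x ≠ 0 := by
    filter_upwards [eventually_ge_atTop b, eventually_gt_atTop 0] with x hx hx0
    exact (mul_pos (Real.rpow_pos_of_pos hx0 _) (hb x hx)).ne'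
  have h1 := (isEquivalent_iff_tendsto_one hv).1 h
  filter_upwards [h1.eventually_ne one_ne_zero] with x hx h0
  exact hx (by simp [h0])

lemma tendsto_tail_ratio {p : PMF ℕ} {β : ℝ} {L : ℝ → ℝ} (hL : IsSlowlyVarying L)
    (h : tail p ~[atTop] fun x => x ^ (-β) * L x) {c : ℝ} (hc : 0 < c) :
    Tendsto (fun x => tail p (c * x) / tail p x) atTop (𝓝 (c ^ (-β))) := by
  obtain ⟨b, hb, -⟩ := hL.pos_measurable
  have hcx : Tendsto (fun x : ℝ => c * x) atTop atTop := tendsto_id.const_mul_atTop hc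
  have h1 : (fun x => tail p (c * x) / tail p x) ~[atTop]
      fun x => ((c * x) ^ (-β) * L (c * x)) / (x ^ (-β) * L x) :=
    (h.comp_tendsto hcx).div h
  refine h1.symm.tendsto_nhds ?_
  have h2 := (hL.tendsto_ratio c hc).const_mul (c ^ (-β))
  rw [mul_one] at h2
  refine h2.congr' ?_
  filter_upwards [eventually_ge_atTop b, eventually_gt_atTop 0] with x hx hx0
  have hLx := hb x hx
  have hxb : 0 < x ^ (-β) := Real.rpow_pos_of_pos hx0 _
  rw [Real.mul_rpow hc.le hx0.le]
  field_simp

/-- Consecutive dyadic terms have limiting ratio `2 ^ (s - β)`, so the ratio test decides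
convergence on either side of `β`. -/
lemma tendsto_dyadic_ratio {p : PMF ℕ} {β : ℝ} {L : ℝ → ℝ} (hL : IsSlowlyVarying L)
    (h : tail p ~[atTop] fun x => x ^ (-β) * L x) (s : ℝ) :
    Tendsto (fun n : ℕ => ‖((2 : ℝ) ^ s) ^ (n + 1) * tail p (2 ^ (n + 1))‖ /
      ‖((2 : ℝ) ^ s) ^ n * tail p (2 ^ n)‖) atTop (𝓝 (2 ^ (s - β))) := by
  have h1 := ((tendsto_tail_ratio hL h (c := 2) two_pos).comp
    (tendsto_pow_atTop_atTop_of_one_lt (one_lt_two (α := ℝ)))).const_mul ((2 : ℝ) ^ s)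
  rw [← Real.rpow_add two_pos, ← sub_eq_add_neg] at h1
  refine h1.congr fun n => ?_
  have h2 : (0 : ℝ) < 2 ^ s := by positivity
  rw [Real.norm_of_nonneg (mul_nonneg (by positivity) (tail_nonneg _ _)),
    Real.norm_of_nonneg (mul_nonneg (by positivity) (tail_nonneg _ _)), pow_succ, pow_succ',
    mul_assoc ((2 ^ s : ℝ) ^ n), mul_div_mul_left _ _ (by positivity), mul_div_assoc]
  simp

lemma eventually_dyadic_ne_zero {p : PMF ℕ} {β : ℝ} {L : ℝ → ℝ} (hL : IsSlowlyVarying L)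
    (h : tail p ~[atTop] fun x => x ^ (-β) * L x) (s : ℝ) :
    ∀ᶠ n : ℕ in atTop, ((2 : ℝ) ^ s) ^ n * tail p (2 ^ n) ≠ 0 := by
  filter_upwards [(tendsto_pow_atTop_atTop_of_one_lt (one_lt_two (α := ℝ))).eventually
    (eventually_tail_ne_zero hL h)] with n hn
  exact mul_ne_zero (by positivity) hn

lemma integrable_rpow_of_summable {p : PMF ℕ} {s : ℝ} (hs : 0 < s)
    (h : Summable fun n : ℕ => ((2 : ℝ) ^ s) ^ n * tail p (2 ^ n)) :
    Integrable (fun x : ℕ => (x : ℝ) ^ s) p.toMeasure := by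
  refine ⟨Measurable.of_discrete.aestronglyMeasurable, ?_⟩
  have hpt (x : ℕ) : ‖(x : ℝ) ^ s‖ₑ ≤ 1 + ∑' n : ℕ, {k : ℕ | (2 : ℝ) ^ n < k}.indicator
      (fun _ => ENNReal.ofReal (((2 : ℝ) ^ s) ^ (n + 1))) x := by
    rw [Real.enorm_of_nonneg (by positivity)]
    rcases le_or_gt (x : ℝ) 1 with hx | hx
    · refine le_trans ?_ le_self_add
      rw [ENNReal.ofReal_le_one]
      exact Real.rpow_le_one (by positivity) hx hs.le
    · obtain ⟨n, hn1, hn2⟩ : ∃ n : ℕ, (2 : ℝ) ^ n < x ∧ (x : ℝ) ≤ 2 ^ (n + 1) := by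
        have hx' : 1 < x := by exact_mod_cast hx
        -- The shift to `x - 1` makes the lower inequality strict, as `tail` requires, also when `x`
        -- is a power of `2`.
        refine ⟨Nat.log 2 (x - 1), ?_, ?_⟩
        · have := Nat.pow_log_le_self 2 (show x - 1 ≠ 0 by omega)
          exact_mod_cast (show 2 ^ Nat.log 2 (x - 1) < x by omega)
        · have := Nat.lt_pow_succ_log_self one_lt_two (x - 1)
          exact_mod_cast (show x ≤ 2 ^ (Nat.log 2 (x - 1) + 1) by omega)
      refine le_trans ?_ (le_add_self.trans' (ENNReal.le_tsum n))
      rw [Set.indicator_of_mem (show x ∈ {k : ℕ | (2 : ℝ) ^ n < k} from hn1)]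
      refine ENNReal.ofReal_le_ofReal ?_
      rw [← Real.rpow_mul_natCast two_pos.le, mul_comm, Real.rpow_natCast_mul two_pos.le]
      exact Real.rpow_le_rpow (by positivity) hn2 hs.le
  refine (lintegral_mono hpt).trans_lt ?_
  rw [lintegral_add_left measurable_const,
    lintegral_tsum fun _ => Measurable.of_discrete.aemeasurable]
  refine ENNReal.add_lt_top.2 ⟨by simp, ?_⟩
  refine lt_of_eq_of_lt ?_ (h.mul_left ((2 : ℝ) ^ s)).tsum_ofReal_lt_top
  congr with n
  rw [lintegral_indicator_const (Set.to_countable _).measurableSet, tail, measureReal_def,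
    ← mul_assoc, ENNReal.ofReal_mul (by positivity), ENNReal.ofReal_toReal (measure_ne_top _ _),
    pow_succ']

lemma integrable_rpow_of_lt {p : PMF ℕ} {β : ℝ} {L : ℝ → ℝ} (hL : IsSlowlyVarying L)
    (h : tail p ~[atTop] fun x => x ^ (-β) * L x) {s : ℝ} (hs : 0 < s) (hsβ : s < β) :
    Integrable (fun x : ℕ => (x : ℝ) ^ s) p.toMeasure :=
  integrable_rpow_of_summable hs <| summable_of_ratio_test_tendsto_lt_one
    (Real.rpow_lt_one_of_one_lt_of_neg one_lt_two (by linarith))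
    (eventually_dyadic_ne_zero hL h s) (tendsto_dyadic_ratio hL h s)

/-- If `β < r < s`, the dyadic series of exponent `r` diverges by the ratio test, while Markov's
inequality with the moment of order `s` bounds it by a geometric series. -/
lemma le_of_integrable_rpow {p : PMF ℕ} {β : ℝ} {L : ℝ → ℝ} (hL : IsSlowlyVarying L)
    (h : tail p ~[atTop] fun x => x ^ (-β) * L x) {s : ℝ} (hs : 0 < s)
    (hi : Integrable (fun x : ℕ => (x : ℝ) ^ s) p.toMeasure) : s ≤ β := by
  by_contra! hβ
  obtain ⟨r, hr1, hr2⟩ := exists_between hβ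
  refine not_summable_of_ratio_test_tendsto_gt_one
    (f := fun n : ℕ => ((2 : ℝ) ^ r) ^ n * tail p (2 ^ n))
    (Real.one_lt_rpow one_lt_two (by linarith))
    (tendsto_dyadic_ratio hL h r) ?_
  set E := ∫ x : ℕ, (x : ℝ) ^ s ∂p.toMeasure
  have hρ : (2 : ℝ) ^ (r - s) < 1 := Real.rpow_lt_one_of_one_lt_of_neg one_lt_two (by linarith)
  refine Summable.of_nonneg_of_le
    (fun n => mul_nonneg (pow_nonneg (Real.rpow_nonneg two_pos.le r) n) (tail_nonneg _ _))
    (fun n => ?_) ((summable_geometric_of_lt_one (by positivity) hρ).mul_left E)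
  have h0 : 0 ≤ᵐ[p.toMeasure] fun x : ℕ => (x : ℝ) ^ s :=
    Eventually.of_forall fun x => Real.rpow_nonneg (Nat.cast_nonneg x) s
  have hm := mul_meas_ge_le_integral_of_nonneg h0 hi (((2 : ℝ) ^ s) ^ n)
  have hT : tail p (2 ^ n) ≤ p.toMeasure.real {x : ℕ | ((2 : ℝ) ^ s) ^ n ≤ (x : ℝ) ^ s} := by
    refine measureReal_mono fun x hx => ?_
    simp only [Set.mem_ofPred_eq] at hx ⊢
    rw [← Real.rpow_mul_natCast two_pos.le, mul_comm, Real.rpow_natCast_mul two_pos.le]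
    exact Real.rpow_le_rpow (by positivity) hx.le hs.le
  have h2 : (2 : ℝ) ^ r = 2 ^ (r - s) * 2 ^ s := by
    rw [← Real.rpow_add two_pos]; simp
  calc ((2 : ℝ) ^ r) ^ n * tail p (2 ^ n)
      = (2 ^ (r - s)) ^ n * (((2 : ℝ) ^ s) ^ n * tail p (2 ^ n)) := by rw [h2]; ring
    _ ≤ (2 ^ (r - s)) ^ n * E := by
        gcongr
        exact (mul_le_mul_of_nonneg_left hT (by positivity)).trans hm
    _ = E * (2 ^ (r - s)) ^ n := mul_comm _ _

lemma one_lt_mean {p : PMF ℕ} (hp0 : p 0 = 0) (hp1 : (p 1).toReal < 1)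
    (hi : Integrable (fun x : ℕ => (x : ℝ)) p.toMeasure) : 1 < mean p := by
  have hind : Integrable (({1} : Set ℕ).indicator fun _ => (1 : ℝ)) p.toMeasure :=
    (integrable_const 1).indicator (by simp)
  have h : ∫ x, (2 - ({1} : Set ℕ).indicator (fun _ => (1 : ℝ)) x) ∂p.toMeasure ≤ mean p := by
    rw [mean_eq_integral hi]
    refine integral_mono_ae ((integrable_const _).sub hind) hi ?_
    -- Pointwise `x ≥ 2 - 1_{x = 1}` for `x ≥ 1`, so the mean is at least `2 - p₁`.
    filter_upwards [ae_one_le hp0] with x hx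
    rcases hx.eq_or_lt with rfl | hx
    · norm_num
    · have h1 : x ≠ 1 := by omega
      have h2 : (2 : ℝ) ≤ x := by exact_mod_cast hx
      simpa [h1] using h2
  rw [integral_sub (integrable_const _) hind, integral_indicator_singleton] at h
  simp only [integral_const, probReal_univ, one_smul] at h
  linarith

lemma mean_rpow_schroder_mul {p : PMF ℕ} (hm : 1 < mean p) (hp1 : 0 < (p 1).toReal) :
    mean p ^ schroder p * (p 1).toReal = 1 := by
  rw [schroder, Real.rpow_neg (by linarith), Real.rpow_logb (by linarith) (by linarith) hp1,
    inv_mul_cancel₀ hp1.ne']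

lemma isRegular_schroder {p : PMF ℕ} (hp0 : p 0 = 0) (hp1 : 0 < (p 1).toReal)
    (hp1' : (p 1).toReal < 1) {β : ℝ} (hβ1 : 1 < β) (hβ2 : β < 2) {L : ℝ → ℝ}
    (hL : IsSlowlyVarying L) (htail : tail p ~[atTop] fun x => x ^ (-β) * L x)
    (hγ : schroder p < β - 1 ∨
      Integrable (fun x : ℕ => (x : ℝ) ^ (1 + schroder p)) p.toMeasure) :
    IsRegular p (schroder p) := by
  have hi : Integrable (fun x : ℕ => (x : ℝ)) p.toMeasure := by
    simpa using integrable_rpow_of_lt hL htail one_pos hβ1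
  have hm := one_lt_mean hp0 hp1' hi
  have hpos : 0 < schroder p := neg_pos.2 (Real.logb_neg hm hp1 hp1')
  have hir : Integrable (fun x : ℕ => (x : ℝ) ^ (1 + schroder p)) p.toMeasure :=
    hγ.elim (fun h => integrable_rpow_of_lt hL htail (by linarith) (by linarith)) id
  -- In both cases `1 + γ ≤ β < 2`, which yields `γ < 1`.
  have hle := le_of_integrable_rpow hL htail (by linarith) hir
  exact ⟨hp0, hp1, hp1', hm, hpos, by linarith, hi, hir⟩

end GaltonWatson

theorem mainTheorem6 {Ω : Type*} [MeasurableSpace Ω] (μ : Measure Ω) [IsProbabilityMeasure μ]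
    (p : PMF ℕ) (hp0 : p 0 = 0) (hp1 : 0 < p 1) (hp1' : p 1 < 1)
    (ξ : ℕ → ℕ → Ω → ℕ) (hξ : GaltonWatson.IsOffspringArray μ p ξ)
    (β : ℝ) (hβ1 : 1 < β) (hβ2 : β < 2) (L : ℝ → ℝ) (hL : IsSlowlyVarying L)
    (htail : (fun x : ℝ => μ.real {ω | x < (GaltonWatson.Z ξ 1 ω : ℝ)})
      ~[atTop] (fun x : ℝ => x ^ (-β) * L x))
    (hγ : GaltonWatson.schroder p < β - 1 ∨
      Integrable (fun ω => (GaltonWatson.Z ξ 1 ω : ℝ) ^ (1 + GaltonWatson.schroder p)) μ) :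
    ∃ q : ℕ → ℝ,
      (∀ k : ℕ, 1 ≤ k → Tendsto
        (fun n : ℕ => GaltonWatson.mean p ^ (GaltonWatson.schroder p * (n : ℝ)) *
          μ.real {ω | GaltonWatson.Z ξ n ω = k}) atTop (𝓝 (q k))) ∧
      ∀ ε : ℝ, 0 < ε →
        Summable (fun k : ℕ => q (k + 1) * GaltonWatson.meanDeviation p (k + 1) ε) ∧
        Tendsto
          (fun n : ℕ => GaltonWatson.mean p ^ (GaltonWatson.schroder p * (n : ℝ)) *
            μ.real {ω | ε ≤ |(GaltonWatson.Z ξ (n + 1) ω : ℝ) / (GaltonWatson.Z ξ n ω : ℝ)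
              - GaltonWatson.mean p|})
          atTop (𝓝 (∑' k : ℕ, q (k + 1) * GaltonWatson.meanDeviation p (k + 1) ε)) := by
  have hZ : ∀ ω, GaltonWatson.Z ξ 1 ω = ξ 0 0 ω := fun ω => by simp [GaltonWatson.Z]
  have hp1r : 0 < (p 1).toReal := ENNReal.toReal_pos hp1.ne' (PMF.apply_ne_top _ _)
  have hp1r' : (p 1).toReal < 1 := by
    simpa using ENNReal.toReal_strict_mono ENNReal.one_ne_top hp1'
  have htail' : GaltonWatson.tail p ~[atTop] fun x => x ^ (-β) * L x := by
    have e : (fun x : ℝ => μ.real {ω | x < (GaltonWatson.Z ξ 1 ω : ℝ)}) = GaltonWatson.tail p := by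
      ext x
      rw [GaltonWatson.tail, ← hξ.law 0 0,
        map_measureReal_apply (hξ.measurable 0 0) (Set.to_countable _).measurableSet]
      simp only [hZ]
      rfl
    rwa [e] at htail
  have hγ' : GaltonWatson.schroder p < β - 1 ∨
      Integrable (fun x : ℕ => (x : ℝ) ^ (1 + GaltonWatson.schroder p)) p.toMeasure := by
    refine hγ.imp_right fun h => ?_
    rw [← hξ.law 0 0, integrable_map_measure Measurable.of_discrete.aestronglyMeasurable
      (hξ.measurable 0 0).aemeasurable]
    simp only [hZ] at h
    exact h
  have hreg := GaltonWatson.isRegular_schroder hp0 hp1r hp1r' hβ1 hβ2 hL htail' hγ'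
  have hs := GaltonWatson.mean_rpow_schroder_mul hreg.one_lt_mean hp1r
  have hpow (n : ℕ) : GaltonWatson.mean p ^ (GaltonWatson.schroder p * (n : ℝ)) =
      ((p 1).toReal ^ n)⁻¹ := by
    rw [Real.rpow_mul_natCast (by linarith [hreg.one_lt_mean]), ← inv_pow,
      ← eq_inv_of_mul_eq_one_left hs]
  obtain ⟨q, hq, hdev⟩ := hreg.tendsto_deviation hs
  refine ⟨q, fun k _ => (hq k).congr fun n => ?_, fun ε hε => ⟨(hdev ε hε).1,
    (hdev ε hε).2.congr fun n => ?_⟩⟩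
  · rw [hpow, measureReal_def, hξ.measure_Z_eq, GaltonWatson.scaledLaw, div_eq_inv_mul]
  · rw [hpow, hξ.measureReal_deviation, ← tsum_mul_left]
    simp_rw [GaltonWatson.scaledLaw, div_eq_inv_mul, mul_assoc]
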